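/- Let $d$ be odd and let $\mathcal A=\{H_1,\dots,H_n\}$ be a simple arrangement of $n\ge 1$ affine hyperplanes in $\mathbb R^d$, that is, an indexed family such that, for $0\le k\le d$, any $k$ of the hyperplanes meet in an affine subspace of dimension $d-k$, and any $d+1$ or more of them have empty intersection. For each $i$ let a positive side of $H_i$ (an open halfspace $H_i^+$ bounded by $H_i$) be specified. A tope of $\mathcal A$ is a connected component of $\mathbb R^d\setminus\bigcup_i H_i$; let $\mathcal T(\mathcal A)$ be the set of all topes and $\mathcal T_b(\mathcal A)$ the set of bounded topes. For a set $\mathcal T$ of topes of an arrangement put $$s(\mathcal T)=\sum_{T\in\mathcal T}(-1)^{\sigma(T)},$$ where $\sigma(T)$ is the number of indices $i$ with $T\subseteq H_i^+$ (the signed odd-even invariant of $\mathcal T$). Let $\mathcal A_\infty$ be the central arrangement, indexed in the same way, obtained by translating each $H_i$, together with its positive side, so that it contains the origin. If $n$ is odd, then $s(\mathcal T(\mathcal A))=s(\mathcal T(\mathcal A_\infty))=s(\mathcal T_b(\mathcal A))=0$. If $n$ is even, then $s(\mathcal T_b(\mathcal A))=-\tfrac12\, s(\mathcal T(\mathcal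 A_\infty))$. -/

import Mathlib

/-- An affine hyperplane of `ℝ^d` together with a choice of its positive side: the hyperplane is
`{x | ⟪normal, x⟫ = offset}`, and the nonzero normal vector points to the positive side. -/
structure OrientedHyperplane (d : ℕ) where
  normal : EuclideanSpace ℝ (Fin d)
  normal_ne_zero : normal ≠ 0
  offset : ℝ

namespace OrientedHyperplane

/-- The underlying affine subspace, of dimension `d - 1`. -/
def toAffineSubspace {d : ℕ} (h : OrientedHyperplane d) :
    AffineSubspace ℝ (EuclideanSpace ℝ (Fin d)) where
  carrier := {x | inner ℝ h.normal x = h.offset}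
  smul_vsub_vadd_mem' := by
    intro c p q r hp hq hr
    simp only [Set.mem_ofPred_eq] at hp hq hr ⊢
    simp [inner_add_right, inner_sub_right, inner_smul_right, hp, hq, hr]

/-- The open halfspace on the positive side. -/
def posSide {d : ℕ} (h : OrientedHyperplane d) : Set (EuclideanSpace ℝ (Fin d)) :=
  {x | h.offset < inner ℝ h.normal x}

/-- The translate of an oriented hyperplane that contains the origin (its positive side is
translated along with it). -/
def translateToOrigin {d : ℕ} (h : OrientedHyperplane d) : OrientedHyperplane d where
  normal := h.normal
  normal_ne_zero := h.normal_ne_zero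
  offset := 0

end OrientedHyperplane

/-- An arrangement of `n` hyperplanes in `ℝ^d`: an indexed family of hyperplanes, each with a
specified positive side. Repetitions are allowed. -/
abbrev HyperplaneArrangement (d n : ℕ) : Type := Fin n → OrientedHyperplane d

namespace HyperplaneArrangement

/-- The intersection of the hyperplanes with index in `S` (the whole space if `S` is empty). -/
noncomputable def inter {d n : ℕ} (A : HyperplaneArrangement d n) (S : Finset (Fin n)) :
    AffineSubspace ℝ (EuclideanSpace ℝ (Fin d)) :=
  ⨅ i ∈ S, (A i).toAffineSubspace

/-- An arrangement is simple if, for `0 ≤ k ≤ d`, any `k` of its hyperplanes intersect in a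
(nonempty) affine subspace of dimension `d - k`, and any `d + 1` or more of its hyperplanes have
empty intersection. -/
def IsSimple {d n : ℕ} (A : HyperplaneArrangement d n) : Prop :=
  (∀ S : Finset (Fin n), S.card ≤ d →
    (A.inter S : Set (EuclideanSpace ℝ (Fin d))).Nonempty ∧
      Module.finrank ℝ (A.inter S).direction = d - S.card) ∧
  (∀ S : Finset (Fin n), d + 1 ≤ S.card →
    (A.inter S : Set (EuclideanSpace ℝ (Fin d))) = ∅)

/-- The complement of the union of the hyperplanes. -/
def complement {d n : ℕ} (A : HyperplaneArrangement d n) : Set (EuclideanSpace ℝ (Fin d)) :=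
  (⋃ i, ((A i).toAffineSubspace : Set (EuclideanSpace ℝ (Fin d))))ᶜ

/-- `T` is a tope: a connected component of the complement of the union of the hyperplanes. -/
def IsTope {d n : ℕ} (A : HyperplaneArrangement d n) (T : Set (EuclideanSpace ℝ (Fin d))) :
    Prop :=
  ∃ x ∈ A.complement, T = connectedComponentIn A.complement x

/-- Two points off the hyperplanes with the same set of positive sides lie in the same tope. -/
theorem connectedComponentIn_eq_of_sides {d n : ℕ} (A : HyperplaneArrangement d n)
    {x y : EuclideanSpace ℝ (Fin d)} (hx : x ∈ A.complement) (hy : y ∈ A.complement)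
    (hxy : {i | x ∈ (A i).posSide} = {i | y ∈ (A i).posSide}) :
    connectedComponentIn A.complement x = connectedComponentIn A.complement y := by
  have mem_compl : ∀ z, z ∈ A.complement ↔ ∀ i, inner ℝ (A i).normal z ≠ (A i).offset := by
    intro z
    simp only [complement, Set.mem_compl_iff, Set.mem_iUnion, not_exists]
    exact Iff.rfl
  rw [mem_compl] at hx hy
  have hside : ∀ i, (A i).offset < inner ℝ (A i).normal x ↔
      (A i).offset < inner ℝ (A i).normal y := fun i => Set.ext_iff.mp hxy i
  have hseg : segment ℝ x y ⊆ A.complement := by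
    rintro z ⟨a, b, ha, hb, hab, rfl⟩
    rw [mem_compl]
    intro i
    rw [inner_add_right, inner_smul_right, inner_smul_right]
    obtain rfl : b = 1 - a := by linarith
    rcases lt_or_gt_of_ne (hx i) with h | h
    · have h2 : inner ℝ (A i).normal y < (A i).offset :=
        lt_of_le_of_ne (not_lt.mp fun h3 => absurd ((hside i).mpr h3) (not_lt.mpr h.le)) (hy i)
      apply ne_of_lt
      rcases ha.eq_or_lt with rfl | ha
      · linarith
      · nlinarith [mul_lt_mul_of_pos_left h ha, mul_le_mul_of_nonneg_left h2.le hb]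
    · have h2 := (hside i).mp h
      apply ne_of_gt
      rcases ha.eq_or_lt with rfl | ha
      · linarith
      · nlinarith [mul_lt_mul_of_pos_left h ha, mul_le_mul_of_nonneg_left h2.le hb]
  apply connectedComponentIn_eq
  exact (convex_segment x y).isPreconnected.subset_connectedComponentIn
    (left_mem_segment ℝ x y) hseg (right_mem_segment ℝ x y)

/-- An arrangement has only finitely many topes. -/
theorem finite_setOf_isTope {d n : ℕ} (A : HyperplaneArrangement d n) :
    {T | A.IsTope T}.Finite := by
  classical
  let f : Set (Fin n) → Set (EuclideanSpace ℝ (Fin d)) := fun s =>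
    if h : ∃ x ∈ A.complement, {i | x ∈ (A i).posSide} = s then
      connectedComponentIn A.complement h.choose else ∅
  refine (Set.finite_range f).subset ?_
  rintro T ⟨x, hx, rfl⟩
  have h : ∃ z ∈ A.complement, {i | z ∈ (A i).posSide} = {i | x ∈ (A i).posSide} := ⟨x, hx, rfl⟩
  refine ⟨{i | x ∈ (A i).posSide}, ?_⟩
  simp only [f, dif_pos h]
  exact A.connectedComponentIn_eq_of_sides h.choose_spec.1 hx h.choose_spec.2

/-- The finite set of all topes of the arrangement. -/
noncomputable def topes {d n : ℕ} (A : HyperplaneArrangement d n) :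
    Finset (Set (EuclideanSpace ℝ (Fin d))) :=
  A.finite_setOf_isTope.toFinset

open Classical in
/-- The finite set of all bounded topes of the arrangement. -/
noncomputable def boundedTopes {d n : ℕ} (A : HyperplaneArrangement d n) :
    Finset (Set (EuclideanSpace ℝ (Fin d))) :=
  A.topes.filter fun T => Bornology.IsBounded T

open Classical in
/-- The number of (indices of) hyperplanes on whose positive side `T` lies. -/
noncomputable def sigma {d n : ℕ} (A : HyperplaneArrangement d n)
    (T : Set (EuclideanSpace ℝ (Fin d))) : ℕ :=
  (Finset.univ.filter fun i : Fin n => T ⊆ (A i).posSide).card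

/-- The signed odd-even invariant of a set of topes of the arrangement. -/
noncomputable def signedOddEven {d n : ℕ} (A : HyperplaneArrangement d n)
    (𝒯 : Finset (Set (EuclideanSpace ℝ (Fin d)))) : ℤ :=
  ∑ T ∈ 𝒯, (-1 : ℤ) ^ A.sigma T

/-- The central arrangement of the translates through the origin of the hyperplanes; it is indexed
by the same set and hence may have repeated hyperplanes (when `d = 1`, say). -/
def atInfinity {d n : ℕ} (A : HyperplaneArrangement d n) : HyperplaneArrangement d n :=
  fun i => (A i).translateToOrigin

end HyperplaneArrangement

/-!
The affine forms of a simple arrangement satisfy an Euler relation: the alternating sum, by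
codimension, over the nonempty faces of a sign cell is `(-1) ^ d` if the cell is nonempty and its
recession cone has empty interior, and `0` otherwise. By deletion and restriction, the failure of
this relation is negated when one sign of the cell is flipped, and it vanishes at an infeasible
choice of signs. In the sum of the relations over all cells, signed by the number of positive signs,
the proper faces cancel, since a form that vanishes on a face may be given either sign; what is left
is `s(T) = (-1) ^ d * (s(T) - s(T_∞))`, that is, `2 * s(T) = s(T_∞)` for odd `d`. The bounded topes
are those whose recession cone has empty interior, whence `s(T_b) = s(T) - s(T_∞)`; finally
`s(T_∞) = 0` for odd `n` by the antipodal map.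
-/

open AffineSpace Bornology Filter Module Topology
open scoped Finset

section LinearForms

variable {ι K V : Type*} [Field K] [AddCommGroup V] [Module K V]

theorem surjective_pi_of_linearIndependent [Finite ι] {g : ι → Dual K V}
    (hg : LinearIndependent K g) : Function.Surjective (LinearMap.pi g) := by
  classical
  have := Fintype.ofFinite ι
  rw [← LinearMap.range_eq_top]
  by_contra hne
  obtain ⟨φ, hφ, hle⟩ := Submodule.exists_le_ker_of_lt_top _ (lt_top_iff_ne_top.mpr hne)
  have hsum : ∑ i, φ (Pi.single i 1) • g i = 0 := by
    ext v
    have hv : φ (LinearMap.pi g v) = 0 := hle (LinearMap.mem_range_self _ v)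
    rw [← Finset.univ_sum_single (LinearMap.pi g v), map_sum] at hv
    have hsingle : ∀ i, φ (Pi.single i (g i v)) = φ (Pi.single i 1) * g i v := fun i => by
      rw [mul_comm, ← smul_eq_mul, ← map_smul, ← Pi.single_smul, smul_eq_mul, mul_one]
    simpa [hsingle] using hv
  refine hφ (LinearMap.pi_ext' fun i => LinearMap.ext_ring ?_)
  simpa using Fintype.linearIndependent_iff.mp hg _ hsum i

theorem exists_forall_mem_eq_of_linearIndepOn {g : ι → Dual K V} {S : Finset ι}
    (hg : LinearIndepOn K g S) (y : ι → K) : ∃ v, ∀ i ∈ S, g i v = y i := by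
  obtain ⟨v, hv⟩ := surjective_pi_of_linearIndependent hg fun i => y i
  exact ⟨v, fun i hi => congrFun hv ⟨i, hi⟩⟩

theorem eq_zero_of_linearIndepOn_of_finrank_le_card [FiniteDimensional K V] {g : ι → Dual K V}
    {S : Finset ι} (hg : LinearIndepOn K g S) (hS : finrank K V ≤ #S) {v : V}
    (hv : ∀ i ∈ S, g i v = 0) : v = 0 := by
  have hsurj := surjective_pi_of_linearIndependent hg
  have hcard : finrank K V = finrank K (S → K) :=
    le_antisymm (by simpa using hS) (LinearMap.finrank_le_finrank_of_surjective hsurj)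
  refine (LinearMap.injective_iff_surjective_of_finrank_eq_finrank hcard).mpr hsurj ?_
  ext i
  simpa using hv i i.2

end LinearForms

section SignCells

variable {ι K V E : Type*} [Field K] [AddCommGroup V] [Module K V] [AddTorsor V E]

/-- The central arrangement at infinity: the linear parts of the given affine forms, as affine forms
on the space of directions. -/
def linearParts (f : ι → E →ᵃ[K] K) (i : ι) : V →ᵃ[K] K := (f i).linear.toAffineMap

/-- The affine forms `f i` define a simple arrangement: up to `finrank K V` of them have linearly
independent linear parts, and no more than that many vanish at a common point. -/
structure InGeneralPosition (f : ι → E →ᵃ[K] K) : Prop where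
  linearIndepOn : ∀ S : Finset ι, #S ≤ finrank K V → LinearIndepOn K (fun i => (f i).linear) S
  card_le : ∀ (S : Finset ι) (x : E), (∀ i ∈ S, f i x = 0) → #S ≤ finrank K V

variable {f : ι → E →ᵃ[K] K} {P N Z S : Finset ι} {i : ι}

theorem InGeneralPosition.eq_zero_of_finrank_le_card [FiniteDimensional K V]
    (hf : InGeneralPosition f) (hS : finrank K V ≤ #S) {v : V}
    (hv : ∀ i ∈ S, (f i).linear v = 0) : v = 0 :=
  have ⟨T, hTS, hT⟩ := Finset.exists_subset_card_eq hS
  eq_zero_of_linearIndepOn_of_finrank_le_card (hf.linearIndepOn T hT.le) hT.ge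
    fun i hi => hv i (hTS hi)

variable [LinearOrder K]

/-- The relatively open cell of the arrangement of the zero sets of the affine forms `f i` on which
the forms indexed by `P`, `N` and `Z` are positive, negative and zero, respectively. -/
def signCell (f : ι → E →ᵃ[K] K) (P N Z : Finset ι) : Set E :=
  {x | (∀ i ∈ P, 0 < f i x) ∧ (∀ i ∈ N, f i x < 0) ∧ ∀ i ∈ Z, f i x = 0}

open Classical in
/-- The number of nonempty cells, `0` or `1`, with the prescribed signs. -/
noncomputable def feasibility (f : ι → E →ᵃ[K] K) (P N Z : Finset ι) : ℤ :=
  if (signCell f P N Z).Nonempty then 1 else 0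

theorem feasibility_of_nonempty (h : (signCell f P N Z).Nonempty) : feasibility f P N Z = 1 :=
  if_pos h

theorem feasibility_of_not_nonempty (h : ¬ (signCell f P N Z).Nonempty) :
    feasibility f P N Z = 0 :=
  if_neg h

theorem InGeneralPosition.linearIndepOn_of_nonempty (hf : InGeneralPosition f)
    (h : (signCell f P N Z).Nonempty) : LinearIndepOn K (fun i => (f i).linear) (Z : Set ι) :=
  let ⟨x, hx⟩ := h
  hf.linearIndepOn Z (hf.card_le Z x hx.2.2)

theorem ne_zero_of_mem_signCell_linearParts [DecidableEq ι] (hne : (P ∪ N).Nonempty) {v : V}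
    (hv : v ∈ signCell (linearParts f) P N Z) : v ≠ 0 := by
  rintro rfl
  obtain ⟨i, hi⟩ := hne
  rcases Finset.mem_union.mp hi with hi | hi
  · exact (hv.1 i hi).ne' (map_zero (f i).linear)
  · exact (hv.2.1 i hi).ne (map_zero (f i).linear)

theorem signCell_nonempty_iff_insert [DecidableEq ι] : (signCell f P N Z).Nonempty ↔
    (signCell f (insert i P) N Z).Nonempty ∨ (signCell f P (insert i N) Z).Nonempty ∨
      (signCell f P N (insert i Z)).Nonempty := by
  simp only [signCell, Set.nonempty_def, Finset.forall_mem_insert, ← exists_or]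
  refine exists_congr fun x => ?_
  have := lt_trichotomy (f i x) 0
  simp only [Set.mem_ofPred_eq]
  tauto

variable [IsStrictOrderedRing K]

theorem feasibility_linearParts_comm :
    feasibility (linearParts f) P N Z = feasibility (linearParts f) N P Z := by
  have hneg : ∀ P N : Finset ι, (signCell (linearParts f) P N Z).Nonempty →
      (signCell (linearParts f) N P Z).Nonempty := by
    rintro P N ⟨v, hP, hN, hZ⟩
    exact ⟨-v, fun i hi => by simpa [linearParts] using hN i hi,
      fun i hi => by simpa [linearParts] using hP i hi,
      fun i hi => by simpa [linearParts] using hZ i hi⟩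
  classical
  exact if_congr ⟨hneg P N, hneg N P⟩ rfl rfl

theorem exists_pos_forall_pos_add_mul (S : Finset ι) {a b : ι → K}
    (h : ∀ i ∈ S, 0 < a i ∨ a i = 0 ∧ 0 < b i) :
    ∃ δ > 0, ∀ ε ∈ Set.Ioc 0 δ, ∀ i ∈ S, 0 < a i + ε * b i := by
  classical
  induction S using Finset.induction_on with
  | empty => exact ⟨1, one_pos, by simp⟩
  | insert i S _ ih =>
    obtain ⟨δ, hδ, hS⟩ := ih fun j hj => h j (Finset.mem_insert_of_mem hj)
    obtain ⟨γ, hγ, hi⟩ : ∃ γ > 0, ∀ ε ∈ Set.Ioc 0 γ, 0 < a i + ε * b i := by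
      rcases h i (Finset.mem_insert_self i S) with ha | ⟨ha, hb⟩
      · have hb : 0 < |b i| + 1 := by positivity
        refine ⟨a i / (|b i| + 1), div_pos ha hb, fun ε hε => ?_⟩
        have hle : ε * (|b i| + 1) ≤ a i := (le_div_iff₀ hb).mp hε.2
        linarith [mul_le_mul_of_nonneg_left (neg_abs_le (b i)) hε.1.le, hε.1]
      · exact ⟨1, one_pos, fun ε hε => by rw [ha, zero_add]; exact mul_pos hε.1 hb⟩
    refine ⟨min δ γ, lt_min hδ hγ, fun ε hε => Finset.forall_mem_insert .. |>.mpr ⟨?_, ?_⟩⟩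
    · exact hi ε ⟨hε.1, hε.2.trans (min_le_right _ _)⟩
    · exact hS ε ⟨hε.1, hε.2.trans (min_le_left _ _)⟩

theorem signCell_nonempty_of_linearIndepOn_union [DecidableEq ι] (hPN : Disjoint P N)
    (hZ : Disjoint (P ∪ N) Z)
    (hlin : LinearIndepOn K (fun i => (f i).linear) (P ∪ N ∪ Z : Finset ι)) :
    (signCell f P N Z).Nonempty := by
  obtain ⟨x⟩ : Nonempty E := inferInstance
  obtain ⟨v, hv⟩ := exists_forall_mem_eq_of_linearIndepOn hlin
    fun i => (if i ∈ P then 1 else if i ∈ N then -1 else 0) - f i x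
  have hvx : ∀ i ∈ P ∪ N ∪ Z, f i (v +ᵥ x) = if i ∈ P then 1 else if i ∈ N then -1 else 0 :=
    fun i hi => by rw [AffineMap.map_vadd, hv i hi, vadd_eq_add, sub_add_cancel]
  refine ⟨v +ᵥ x, fun i hi => ?_, fun i hi => ?_, fun i hi => ?_⟩ <;>
    rw [hvx i (by simp [hi])]
  · simp [hi]
  · simp [hi, Finset.disjoint_right.mp hPN hi]
  · have hiPN := Finset.disjoint_right.mp hZ hi
    rw [Finset.mem_union, not_or] at hiPN
    simp [hiPN]

/-- By independence a point of the face can be pushed off the hyperplanes in `S`, each to the side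
prescribed by `P` and `N`. -/
theorem signCell_nonempty_of_face [DecidableEq ι] (hPN : Disjoint P N)
    (hZ : Disjoint (P ∪ N) Z)
    (hlin : LinearIndepOn K (fun i => (f i).linear) (Z ∪ S : Finset ι))
    (h : (signCell f (P \ S) (N \ S) (Z ∪ S)).Nonempty) : (signCell f P N Z).Nonempty := by
  obtain ⟨x, hxP, hxN, hxZ⟩ := h
  obtain ⟨v, hv⟩ := exists_forall_mem_eq_of_linearIndepOn hlin
    fun i => if i ∈ P then 1 else if i ∈ N then -1 else 0
  have hP : ∀ i ∈ P, 0 < f i x ∨ f i x = 0 ∧ 0 < (f i).linear v := fun i hi => by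
    by_cases hiS : i ∈ S
    · have hiZS := Finset.mem_union_right Z hiS
      exact .inr ⟨hxZ i hiZS, by simp [hv i hiZS, hi]⟩
    · exact .inl (hxP i (Finset.mem_sdiff.mpr ⟨hi, hiS⟩))
  have hN : ∀ i ∈ N, 0 < -f i x ∨ -f i x = 0 ∧ 0 < -(f i).linear v := fun i hi => by
    by_cases hiS : i ∈ S
    · have hiZS := Finset.mem_union_right Z hiS
      exact .inr ⟨by simp [hxZ i hiZS], by
        simp [hv i hiZS, hi, Finset.disjoint_right.mp hPN hi]⟩
    · exact .inl (neg_pos.mpr (hxN i (Finset.mem_sdiff.mpr ⟨hi, hiS⟩)))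
  obtain ⟨δ, hδ, hδP⟩ := exists_pos_forall_pos_add_mul P hP
  obtain ⟨γ, hγ, hγN⟩ := exists_pos_forall_pos_add_mul N hN
  have hε := lt_min hδ hγ
  have hmap : ∀ i, f i (min δ γ • v +ᵥ x) = f i x + min δ γ * (f i).linear v := fun i => by
    rw [AffineMap.map_vadd, map_smul, vadd_eq_add, smul_eq_mul, add_comm]
  refine ⟨min δ γ • v +ᵥ x, fun i hi => ?_, fun i hi => ?_, fun i hi => ?_⟩ <;> rw [hmap]
  · exact hδP _ ⟨hε, min_le_left _ _⟩ i hi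
  · linarith [hγN _ ⟨hε, min_le_right _ _⟩ i hi]
  · have hiPN := Finset.disjoint_right.mp hZ hi
    rw [Finset.mem_union, not_or] at hiPN
    simp [hxZ i (Finset.mem_union_left S hi), hv i (Finset.mem_union_left S hi), hiPN]

theorem signCell_insert_zero_nonempty [DecidableEq ι]
    (hpos : (signCell f (insert i P) N Z).Nonempty)
    (hneg : (signCell f P (insert i N) Z).Nonempty) : (signCell f P N (insert i Z)).Nonempty := by
  obtain ⟨x, hxP, hxN, hxZ⟩ := hpos
  obtain ⟨y, hyP, hyN, hyZ⟩ := hneg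
  rw [Finset.forall_mem_insert] at hxP hyN
  have hd : 0 < f i x - f i y := by linarith [hxP.1, hyN.1]
  have hmap : ∀ j, f j (AffineMap.lineMap x y (f i x / (f i x - f i y))) =
      (f i x * f j y - f i y * f j x) / (f i x - f i y) := fun j => by
    rw [AffineMap.apply_lineMap, AffineMap.lineMap_apply_ring]
    field_simp
    ring
  refine ⟨AffineMap.lineMap x y (f i x / (f i x - f i y)), fun j hj => ?_, fun j hj => ?_,
    Finset.forall_mem_insert .. |>.mpr ⟨?_, fun j hj => ?_⟩⟩ <;> rw [hmap]
  · refine div_pos ?_ hd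
    linarith [mul_pos hxP.1 (hyP j hj), mul_pos_of_neg_of_neg hyN.1 (neg_neg_of_pos (hxP.2 j hj))]
  · refine div_neg_of_neg_of_pos ?_ hd
    linarith [mul_neg_of_pos_of_neg hxP.1 (hyN.2 j hj), mul_pos_of_neg_of_neg hyN.1 (hxN j hj)]
  · ring
  · simp [hxZ j hj, hyZ j hj]

/-- Deletion and restriction: the hyperplane `i` either cuts a cell into two or misses it. -/
theorem feasibility_insert_add_insert [DecidableEq ι] (hPN : Disjoint P N)
    (hZ : Disjoint (P ∪ N) Z) (hi : i ∉ P ∪ N ∪ Z)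
    (hlin : (signCell f P N (insert i Z)).Nonempty →
      LinearIndepOn K (fun j => (f j).linear) (insert i Z : Finset ι)) :
    feasibility f (insert i P) N Z + feasibility f P (insert i N) Z =
      feasibility f P N Z + feasibility f P N (insert i Z) := by
  have hface : (signCell f P N (insert i Z)).Nonempty →
      (signCell f (insert i P) N Z).Nonempty ∧ (signCell f P (insert i N) Z).Nonempty := by
    intro h
    have hlin := hlin h
    rw [← Finset.union_singleton] at h hlin
    constructor <;> refine signCell_nonempty_of_face ?_ ?_ hlin (by convert h using 2 <;> grind) <;>
      grind
  have hcross := signCell_insert_zero_nonempty (f := f) (P := P) (N := N) (Z := Z) (i := i)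
  have hsplit := signCell_nonempty_iff_insert (f := f) (P := P) (N := N) (Z := Z) (i := i)
  unfold feasibility
  split_ifs <;> first | rfl | tauto

end SignCells

section EulerRelation

theorem sum_mul_eq_of_sum_smul_linear_eq_zero {ι K V E : Type*} [CommRing K] [AddCommGroup V]
    [Module K V] [AddTorsor V E] {f : ι → E →ᵃ[K] K} {l : ι → K} {S : Finset ι}
    (hl : ∑ i ∈ S, l i • (f i).linear = 0) (x y : E) :
    ∑ i ∈ S, l i * f i x = ∑ i ∈ S, l i * f i y := by
  have hxy : ∑ i ∈ S, l i * (f i).linear (x -ᵥ y) = 0 := by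
    simpa using LinearMap.congr_fun hl (x -ᵥ y)
  simpa [AffineMap.linearMap_vsub, mul_sub, sub_eq_zero] using hxy

variable {ι K V E : Type*} [DecidableEq ι] [Field K] [LinearOrder K] [AddCommGroup V] [Module K V]
  [AddTorsor V E]

/-- The alternating sum, by codimension, over the nonempty faces of the cell with signs `P`, `N` and
zeros `W`; here `S` is the set of forms vanishing on the face besides those indexed by `W`. -/
noncomputable def faceSum (f : ι → E →ᵃ[K] K) (P N W : Finset ι) : ℤ :=
  ∑ S ∈ (P ∪ N).powerset, (-1) ^ #S * feasibility f (P \ S) (N \ S) (W ∪ S)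

/-- The failure of the Euler relation for the cell with signs `P`, `N` and zeros `W`, whose face sum
should be `(-1) ^ (finrank K V + #W)` if the cell is nonempty and has no direction of recession that
is interior to the recession cone, and `0` otherwise. -/
noncomputable def eulerDefect (f : ι → E →ᵃ[K] K) (P N W : Finset ι) : ℤ :=
  faceSum f P N W - (-1) ^ (finrank K V + #W) *
    (feasibility f P N W - feasibility (linearParts f) P N W)

variable {f : ι → E →ᵃ[K] K} {P N U W : Finset ι} {i : ι} {l : ι → K}

theorem eq_zero_of_forall_insert_add_insert {M : Type*} [AddGroup M] {F : Finset ι → Finset ι → M}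
    (h : ∀ i P N, i ∉ P ∪ N → Disjoint P N → insert i (P ∪ N) = U →
      F (insert i P) N + F P (insert i N) = 0)
    {P₀ N₀ : Finset ι} (hPN₀ : Disjoint P₀ N₀) (hU₀ : P₀ ∪ N₀ = U) (h₀ : F P₀ N₀ = 0)
    (hPN : Disjoint P N) (hU : P ∪ N = U) : F P N = 0 := by
  have hiff : ∀ P N, Disjoint P N → P ∪ N = U → (F P N = 0 ↔ F ∅ U = 0) := by
    intro P
    induction P using Finset.induction_on with
    | empty =>
      rintro N - rfl
      rw [Finset.empty_union]
    | insert i P hi ih =>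
      intro N hPN hU
      have hiN : i ∉ N := Finset.disjoint_left.mp hPN (Finset.mem_insert_self i P)
      have hPN' : Disjoint P N := hPN.mono_left (Finset.subset_insert i P)
      rw [← ih (insert i N) (Finset.disjoint_insert_right.mpr ⟨hi, hPN'⟩) (by grind),
        eq_neg_of_add_eq_zero_left (h i P N (by simp [hi, hiN]) hPN' (by grind)), neg_eq_zero]
  exact (hiff P N hPN hU).mpr ((hiff P₀ N₀ hPN₀ hU₀).mp h₀)

theorem InGeneralPosition.faceSum_eq_feasibility_of_finrank_le_card (hf : InGeneralPosition f)
    (hW : Disjoint (P ∪ N) W) (hcard : finrank K V ≤ #W) :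
    faceSum f P N W = feasibility f P N W := by
  rw [faceSum, Finset.sum_eq_single ∅]
  · simp
  · intro S hS hne
    rw [feasibility_of_not_nonempty, mul_zero]
    rintro ⟨x, -, -, hx⟩
    have := hf.card_le _ x hx
    have hdisj : Disjoint W S := hW.symm.mono_right (Finset.mem_powerset.mp hS)
    rw [Finset.card_union_of_disjoint hdisj] at this
    have := Finset.card_pos.mpr (Finset.nonempty_iff_ne_empty.mpr hne)
    omega
  · simp

theorem InGeneralPosition.eulerDefect_eq_zero_of_finrank_le_card [FiniteDimensional K V]
    (hf : InGeneralPosition f) (hW : Disjoint (P ∪ N) W) (hne : (P ∪ N).Nonempty)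
    (hcard : finrank K V ≤ #W) : eulerDefect f P N W = 0 := by
  have hlin : ¬ (signCell (linearParts f) P N W).Nonempty := by
    rintro ⟨v, hv⟩
    exact ne_zero_of_mem_signCell_linearParts hne hv (hf.eq_zero_of_finrank_le_card hcard hv.2.2)
  rw [eulerDefect, hf.faceSum_eq_feasibility_of_finrank_le_card hW hcard,
    feasibility_of_not_nonempty hlin]
  by_cases h : (signCell f P N W).Nonempty
  · obtain ⟨x, hx⟩ := h
    rw [(hf.card_le W x hx.2.2).antisymm hcard, Even.neg_one_pow ⟨_, rfl⟩]
    ring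
  · simp [feasibility_of_not_nonempty h]

variable [IsStrictOrderedRing K]

theorem signCell_not_nonempty_of_sum_nonpos (hl : ∀ x, ∑ i ∈ U ∪ W, l i * f i x ≤ 0)
    (hU : ∃ i ∈ U, l i ≠ 0) :
    ¬ (signCell f {i ∈ U | 0 ≤ l i} {i ∈ U | l i < 0} W).Nonempty := by
  rintro ⟨x, hP, hN, hZ⟩
  simp only [Finset.mem_filter, and_imp] at hP hN
  have hpos : ∀ i ∈ U, l i ≠ 0 → 0 < l i * f i x := fun i hi hli => by
    rcases hli.lt_or_gt with h | h
    · exact mul_pos_of_neg_of_neg h (hN i hi h)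
    · exact mul_pos h (hP i hi h.le)
  refine (hl x).not_gt (Finset.sum_pos' (fun i hi => ?_) ?_)
  · by_cases hli : l i = 0
    · simp [hli]
    · rcases Finset.mem_union.mp hi with hi | hi
      · exact (hpos i hi hli).le
      · simp [hZ i hi]
  · obtain ⟨i, hi, hli⟩ := hU
    exact ⟨i, Finset.mem_union_left W hi, hpos i hi hli⟩

theorem exists_signCell_not_nonempty [FiniteDimensional K V]
    (hW : LinearIndepOn K (fun i => (f i).linear) (W : Set ι)) (h : finrank K V < #(U ∪ W)) :
    ∃ P N, Disjoint P N ∧ P ∪ N = U ∧ ¬ (signCell f P N W).Nonempty ∧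
      ¬ (signCell (linearParts f) P N W).Nonempty := by
  obtain ⟨x⟩ : Nonempty E := inferInstance
  have hdep : ¬ LinearIndepOn K (fun i => (f i).linear) (U ∪ W : Finset ι) := fun hUW => by
    have := LinearIndependent.fintype_card_le_finrank hUW
    rw [Subspace.dual_finrank_eq] at this
    simp at this
    omega
  obtain ⟨l, hl, hl₀⟩ := not_linearIndepOn_finset_iff.mp hdep
  have hlU : ∃ i ∈ U, l i ≠ 0 := by
    by_contra! hU
    have hUW : ∑ i ∈ W, l i • (f i).linear = 0 := by
      rw [← hl]
      exact Finset.sum_subset Finset.subset_union_right fun i hi hiW => by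
        rw [hU i ((Finset.mem_union.mp hi).resolve_right hiW), zero_smul]
    have := linearIndepOn_finset_iff.mp hW l hUW
    grind
  obtain ⟨l, hl, hlU, hlx⟩ : ∃ l : ι → K, ∑ i ∈ U ∪ W, l i • (f i).linear = 0 ∧
      (∃ i ∈ U, l i ≠ 0) ∧ ∑ i ∈ U ∪ W, l i * f i x ≤ 0 := by
    rcases le_total (∑ i ∈ U ∪ W, l i * f i x) 0 with h | h
    · exact ⟨l, hl, hlU, h⟩
    · exact ⟨-l, by ext v; simpa using LinearMap.congr_fun hl v, by simpa using hlU,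
        by simpa using h⟩
  refine ⟨{i ∈ U | 0 ≤ l i}, {i ∈ U | l i < 0}, ?_, ?_,
    signCell_not_nonempty_of_sum_nonpos (fun y => ?_) hlU,
    signCell_not_nonempty_of_sum_nonpos (fun v => ?_) hlU⟩
  · exact Finset.disjoint_filter.mpr fun i _ h => h.not_gt
  · simp only [← Finset.filter_or, le_or_gt, Finset.filter_true]
  · exact (sum_mul_eq_of_sum_smul_linear_eq_zero hl y x).trans_le hlx
  · simpa [linearParts] using (LinearMap.congr_fun hl v).le

namespace InGeneralPosition

theorem faceSum_insert_add_insert (hf : InGeneralPosition f) (hPN : Disjoint P N)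
    (hW : Disjoint (P ∪ N) W) (hi : i ∉ P ∪ N ∪ W) :
    faceSum f (insert i P) N W + faceSum f P (insert i N) W =
      faceSum f P N W - faceSum f P N (insert i W) := by
  have hiPN : i ∉ P ∪ N := fun h => hi (Finset.mem_union_left W h)
  simp only [faceSum, Finset.insert_union, Finset.union_insert, Finset.sum_powerset_insert hiPN,
    ← Finset.sum_add_distrib, ← Finset.sum_sub_distrib]
  refine Finset.sum_congr rfl fun S hS => ?_
  have hSPN : S ⊆ P ∪ N := Finset.mem_powerset.mp hS
  have hiS : i ∉ S := fun h => hiPN (hSPN h)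
  have hsplit := feasibility_insert_add_insert (P := P \ S) (N := N \ S) (Z := W ∪ S) (i := i)
    (f := f) (hPN.mono Finset.sdiff_subset Finset.sdiff_subset)
    (by grind [Finset.disjoint_left]) (by grind) hf.linearIndepOn_of_nonempty
  have hP : insert i P \ insert i S = P \ S := by grind
  have hN : insert i N \ insert i S = N \ S := by grind
  rw [Finset.card_insert_of_notMem hiS, Finset.insert_sdiff_of_notMem _ hiS,
    Finset.insert_sdiff_of_notMem _ hiS, hP, hN, Finset.sdiff_insert_of_notMem (by grind),
    Finset.sdiff_insert_of_notMem (by grind)]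
  linear_combination (-1) ^ #S * hsplit

theorem faceSum_eq_zero_of_not_nonempty (hf : InGeneralPosition f) (hPN : Disjoint P N)
    (hW : Disjoint (P ∪ N) W) (h : ¬ (signCell f P N W).Nonempty) : faceSum f P N W = 0 :=
  Finset.sum_eq_zero fun S _ => by
    rw [feasibility_of_not_nonempty, mul_zero]
    exact fun hS => h (signCell_nonempty_of_face hPN hW (hf.linearIndepOn_of_nonempty hS) hS)

theorem faceSum_eq_zero_of_card_le (hf : InGeneralPosition f) (hPN : Disjoint P N)
    (hW : Disjoint (P ∪ N) W) (hne : (P ∪ N).Nonempty) (hcard : #(P ∪ N ∪ W) ≤ finrank K V) :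
    faceSum f P N W = 0 := by
  rw [← Finset.sum_powerset_neg_one_pow_card_of_nonempty hne]
  refine Finset.sum_congr rfl fun S hS => ?_
  have hSPN : S ⊆ P ∪ N := Finset.mem_powerset.mp hS
  have hunion : P \ S ∪ N \ S ∪ (W ∪ S) = P ∪ N ∪ W := by grind
  rw [feasibility_of_nonempty, mul_one]
  refine signCell_nonempty_of_linearIndepOn_union
    (hPN.mono Finset.sdiff_subset Finset.sdiff_subset) (by grind [Finset.disjoint_left]) ?_
  rw [hunion]
  exact hf.linearIndepOn _ hcard

theorem eulerDefect_insert_add_insert (hf : InGeneralPosition f) (hPN : Disjoint P N)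
    (hW : Disjoint (P ∪ N) W) (hi : i ∉ P ∪ N ∪ W) (hcard : #W < finrank K V) :
    eulerDefect f (insert i P) N W + eulerDefect f P (insert i N) W =
      eulerDefect f P N W - eulerDefect f P N (insert i W) := by
  have hiW : i ∉ W := fun h => hi (Finset.mem_union_right _ h)
  have hlin := hf.linearIndepOn (insert i W) ((Finset.card_insert_of_notMem hiW).trans_le hcard)
  have hface := hf.faceSum_insert_add_insert hPN hW hi
  have hfeas := feasibility_insert_add_insert (f := f) hPN hW hi fun _ => hlin
  have hfeas' := feasibility_insert_add_insert (f := linearParts f) hPN hW hi fun _ => hlin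
  simp only [eulerDefect, Finset.card_insert_of_notMem hiW]
  linear_combination hface - (-1) ^ (finrank K V + #W) * (hfeas - hfeas')

theorem eulerDefect_eq_zero_of_card_le (hf : InGeneralPosition f) (hPN : Disjoint P N)
    (hW : Disjoint (P ∪ N) W) (hne : (P ∪ N).Nonempty) (hcard : #(P ∪ N ∪ W) ≤ finrank K V) :
    eulerDefect f P N W = 0 := by
  have hlin := hf.linearIndepOn _ hcard
  rw [eulerDefect, hf.faceSum_eq_zero_of_card_le hPN hW hne hcard,
    feasibility_of_nonempty (signCell_nonempty_of_linearIndepOn_union (f := f) hPN hW hlin),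
    feasibility_of_nonempty
      (signCell_nonempty_of_linearIndepOn_union (f := linearParts f) hPN hW hlin)]
  simp

/-- **Euler relation** for the cells of a simple arrangement, by induction on the number of signs:
flipping a sign negates the defect, and some choice of signs is infeasible. -/
theorem eulerDefect_eq_zero [FiniteDimensional K V] (hf : InGeneralPosition f)
    (hPN : Disjoint P N) (hW : Disjoint (P ∪ N) W) (hne : (P ∪ N).Nonempty) :
    eulerDefect f P N W = 0 := by
  induction hm : #(P ∪ N) generalizing P N W with
  | zero => simp [hne.ne_empty] at hm
  | succ m ih =>
    rcases le_or_gt (finrank K V) #W with hdW | hWd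
    · exact hf.eulerDefect_eq_zero_of_finrank_le_card hW hne hdW
    rcases le_or_gt #(P ∪ N ∪ W) (finrank K V) with hcard | hcard
    · exact hf.eulerDefect_eq_zero_of_card_le hPN hW hne hcard
    obtain ⟨P₀, N₀, hPN₀, hU₀, hempty, hlin⟩ :=
      exists_signCell_not_nonempty (hf.linearIndepOn W hWd.le) hcard
    refine eq_zero_of_forall_insert_add_insert (F := (eulerDefect f · · W))
      (fun i P' N' hi hPN' hU => ?_) hPN₀ hU₀ ?_ hPN rfl
    · have hm' : #(P' ∪ N') = m := by
        rw [← hU, Finset.card_insert_of_notMem hi] at hm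
        omega
      have hcard' := Finset.card_union_of_disjoint hW
      have hne' : (P' ∪ N').Nonempty := Finset.card_pos.mp (by omega)
      rw [hf.eulerDefect_insert_add_insert hPN' (by grind) (by grind) hWd,
        ih hPN' (by grind) hne' hm', ih hPN' (by grind) hne' hm', sub_zero]
    · rw [eulerDefect, hf.faceSum_eq_zero_of_not_nonempty hPN₀ (hU₀ ▸ hW) hempty,
        feasibility_of_not_nonempty hempty, feasibility_of_not_nonempty hlin]
      ring

end InGeneralPosition

end EulerRelation

section SignedCount

variable {ι K V E : Type*} [Fintype ι] [DecidableEq ι]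

theorem sum_neg_one_pow_card_mul_eq_zero (i : ι) {g : Finset ι → ℤ}
    (hg : ∀ P, i ∉ P → g (insert i P) = g P) : ∑ P, (-1) ^ #P * g P = 0 := by
  rw [← Finset.powerset_univ, ← Finset.insert_erase (Finset.mem_univ i),
    Finset.sum_powerset_insert (Finset.notMem_erase i _), ← Finset.sum_add_distrib]
  refine Finset.sum_eq_zero fun P hP => ?_
  have hi : i ∉ P := fun h => Finset.notMem_erase i _ (Finset.mem_powerset.mp hP h)
  rw [hg P hi, Finset.card_insert_of_notMem hi]
  ring

variable [Field K] [LinearOrder K] [AddCommGroup V] [Module K V] [AddTorsor V E]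

/-- The sum of `(-1) ^ #P` over the nonempty full-dimensional cells, `P` being the set of forms that
are positive on the cell. -/
noncomputable def signedCount (f : ι → E →ᵃ[K] K) : ℤ :=
  ∑ P, (-1) ^ #P * feasibility f P Pᶜ ∅

variable {f : ι → E →ᵃ[K] K}

theorem sum_neg_one_pow_card_mul_faceSum :
    ∑ P, (-1) ^ #P * faceSum f P Pᶜ ∅ = signedCount f := by
  simp only [faceSum, Finset.union_compl, Finset.powerset_univ, Finset.empty_union,
    Finset.mul_sum]
  rw [Finset.sum_comm, Finset.sum_eq_single ∅ _ (by simp)]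
  · simp [signedCount]
  -- A form vanishing on the face may be given either sign without changing the face.
  · rintro S - hS
    obtain ⟨i, hi⟩ := Finset.nonempty_iff_ne_empty.mpr hS
    refine sum_neg_one_pow_card_mul_eq_zero i fun P _ => ?_
    have hP : insert i P \ S = P \ S := by grind
    have hN : (insert i P)ᶜ \ S = Pᶜ \ S := by grind [Finset.mem_compl]
    rw [hP, hN]

variable [IsStrictOrderedRing K]

theorem InGeneralPosition.signedCount_eq [Nonempty ι] [FiniteDimensional K V]
    (hf : InGeneralPosition f) : signedCount f =
      (-1) ^ finrank K V * (signedCount f - signedCount (linearParts f)) := by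
  calc
    signedCount f = ∑ P, (-1) ^ #P * faceSum f P Pᶜ ∅ := sum_neg_one_pow_card_mul_faceSum.symm
    _ = ∑ P, (-1) ^ #P * ((-1) ^ finrank K V *
          (feasibility f P Pᶜ ∅ - feasibility (linearParts f) P Pᶜ ∅)) := by
      refine Finset.sum_congr rfl fun P _ => congrArg _ (sub_eq_zero.mp ?_)
      exact hf.eulerDefect_eq_zero disjoint_compl_right (Finset.disjoint_empty_right _) (by simp)
    _ = (-1) ^ finrank K V * (signedCount f - signedCount (linearParts f)) := by
      simp only [signedCount, ← Finset.sum_sub_distrib, Finset.mul_sum]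
      exact Finset.sum_congr rfl fun P _ => by ring

theorem InGeneralPosition.two_mul_signedCount [Nonempty ι] (hd : Odd (finrank K V))
    (hf : InGeneralPosition f) : 2 * signedCount f = signedCount (linearParts f) := by
  have := FiniteDimensional.of_finrank_pos hd.pos
  have hcount := hf.signedCount_eq
  rw [hd.neg_one_pow] at hcount
  linarith

theorem signedCount_linearParts_eq_zero (hι : Odd (Fintype.card ι)) :
    signedCount (linearParts f) = 0 := by
  have hneg : signedCount (linearParts f) = -signedCount (linearParts f) := by
    rw [signedCount, ← Finset.sum_neg_distrib]
    refine Finset.sum_bijective compl compl_bijective (by simp) fun P _ => ?_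
    have hsign : (-1 : ℤ) ^ #Pᶜ = -(-1) ^ #P := by
      have hcard : (-1 : ℤ) ^ #P * (-1) ^ #Pᶜ = -1 := by
        rw [← pow_add, Finset.card_add_card_compl, hι.neg_one_pow]
      have hsq : (-1 : ℤ) ^ #P * (-1) ^ #P = 1 := by rw [← mul_pow, neg_mul_neg, one_mul, one_pow]
      linear_combination (-1) ^ #P * hcard - (-1) ^ #Pᶜ * hsq
    rw [compl_compl, hsign, feasibility_linearParts_comm, neg_mul, neg_neg]
  linarith

end SignedCount

section Boundedness

variable {ι V E : Type*} [NormedAddCommGroup V] [NormedSpace ℝ V] [FiniteDimensional ℝ V]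
  [MetricSpace E] [NormedAddTorsor V E]

theorem tendsto_asymptoticNhds_atTop {g : E →ᵃ[ℝ] ℝ} {v : V} (hv : 0 < g.linear v) :
    Tendsto g (asymptoticNhds ℝ E v) atTop := by
  obtain ⟨p⟩ : Nonempty E := inferInstance
  rw [asymptoticNhds_eq_smul_vadd v p, vadd_pure, ← map₂_smul, ← map_prod_eq_map₂, map_map,
    tendsto_map'_iff]
  have hg : ∀ q : ℝ × V, g (q.1 • q.2 +ᵥ p) = q.1 * g.linear q.2 + g p := fun q => by simp
  simp only [Function.comp_def, hg]
  refine tendsto_atTop_add_const_right _ _ (tendsto_fst.atTop_mul_pos hv ?_)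
  exact (g.linear.continuous_of_finiteDimensional.tendsto v).comp tendsto_snd

theorem tendsto_asymptoticNhds_atBot {g : E →ᵃ[ℝ] ℝ} {v : V} (hv : g.linear v < 0) :
    Tendsto g (asymptoticNhds ℝ E v) atBot :=
  tendsto_neg_atTop_iff.mp (tendsto_asymptoticNhds_atTop (g := -g) (neg_pos.mpr hv))

variable {f : ι → E →ᵃ[ℝ] ℝ} {P N : Finset ι} {v : V}

theorem eventually_asymptoticNhds_mem_signCell (hv : v ∈ signCell (linearParts f) P N ∅) :
    ∀ᶠ x in asymptoticNhds ℝ E v, x ∈ signCell f P N ∅ := by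
  have hP := (P.eventually_all).mpr fun i hi =>
    (tendsto_asymptoticNhds_atTop (hv.1 i hi)).eventually_gt_atTop 0
  have hN := (N.eventually_all).mpr fun i hi =>
    (tendsto_asymptoticNhds_atBot (hv.2.1 i hi)).eventually_lt_atBot 0
  filter_upwards [hP, hN] with x hxP hxN
  exact ⟨hxP, hxN, by simp⟩

theorem signCell_nonempty_of_linearParts (h : (signCell (linearParts f) P N ∅).Nonempty) :
    (signCell f P N ∅).Nonempty :=
  have ⟨_, hv⟩ := h
  (eventually_asymptoticNhds_mem_signCell hv).exists

theorem linear_nonneg_of_mem_asymptoticCone {Z : Finset ι} {i : ι} (hi : i ∈ P)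
    (hv : v ∈ asymptoticCone ℝ (signCell f P N Z)) : 0 ≤ (f i).linear v := by
  by_contra! hneg
  obtain ⟨x, hx, hlt⟩ := (hv.and_eventually
    ((tendsto_asymptoticNhds_atBot hneg).eventually_lt_atBot 0)).exists
  exact hlt.not_gt (hx.1 i hi)

theorem linear_nonpos_of_mem_asymptoticCone {Z : Finset ι} {i : ι} (hi : i ∈ N)
    (hv : v ∈ asymptoticCone ℝ (signCell f P N Z)) : (f i).linear v ≤ 0 := by
  by_contra! hpos
  obtain ⟨x, hx, hgt⟩ := (hv.and_eventually
    ((tendsto_asymptoticNhds_atTop hpos).eventually_gt_atTop 0)).exists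
  exact hgt.not_gt (hx.2.1 i hi)

variable [Fintype ι] [DecidableEq ι]

theorem InGeneralPosition.isBounded_signCell_iff [Nonempty ι] (hf : InGeneralPosition f) :
    IsBounded (signCell f P Pᶜ ∅) ↔ ¬ (signCell (linearParts f) P Pᶜ ∅).Nonempty := by
  rw [← not_iff_not, not_not, not_bounded_iff_exists_ne_zero_mem_asymptoticCone]
  constructor
  · rintro ⟨v, hv₀, hv⟩
    set S : Finset ι := {i | (f i).linear v = 0}
    have hS : #S ≤ finrank ℝ V := by
      by_contra! hlt
      exact hv₀ (hf.eq_zero_of_finrank_le_card hlt.le fun i hi => (Finset.mem_filter.mp hi).2)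
    refine signCell_nonempty_of_face (S := S) disjoint_compl_right (Finset.disjoint_empty_right _)
      (by rw [Finset.empty_union]; exact hf.linearIndepOn S hS)
      ⟨v, fun i hi => ?_, fun i hi => ?_, by simp [S, linearParts]⟩
    · have hne : (f i).linear v ≠ 0 := by simpa [S] using (Finset.mem_sdiff.mp hi).2
      exact (linear_nonneg_of_mem_asymptoticCone (Finset.mem_sdiff.mp hi).1 hv).lt_of_ne' hne
    · have hne : (f i).linear v ≠ 0 := by simpa [S] using (Finset.mem_sdiff.mp hi).2
      exact (linear_nonpos_of_mem_asymptoticCone (Finset.mem_sdiff.mp hi).1 hv).lt_of_ne hne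
  · rintro ⟨v, hv⟩
    exact ⟨v, ne_zero_of_mem_signCell_linearParts (by simp) hv,
      (eventually_asymptoticNhds_mem_signCell hv).frequently⟩

end Boundedness

namespace OrientedHyperplane

variable {d : ℕ} {h : OrientedHyperplane d} {x : EuclideanSpace ℝ (Fin d)}

/-- The affine form that vanishes on the hyperplane and is positive on its positive side. -/
noncomputable def form (h : OrientedHyperplane d) : EuclideanSpace ℝ (Fin d) →ᵃ[ℝ] ℝ :=
  (innerₛₗ ℝ h.normal).toAffineMap - AffineMap.const ℝ _ h.offset

theorem mem_posSide_iff : x ∈ h.posSide ↔ 0 < h.form x :=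
  (sub_pos (a := inner ℝ h.normal x)).symm

theorem mem_toAffineSubspace_iff : x ∈ h.toAffineSubspace ↔ h.form x = 0 := sub_eq_zero.symm

theorem form_translateToOrigin : h.translateToOrigin.form = h.form.linear.toAffineMap := by
  ext x
  simp [form, translateToOrigin]

end OrientedHyperplane

namespace HyperplaneArrangement

variable {d n : ℕ} {A : HyperplaneArrangement d n} {P S : Finset (Fin n)}
  {i : Fin n} {x y : EuclideanSpace ℝ (Fin d)}

/-- The affine forms of the hyperplanes of the arrangement. -/
noncomputable def forms (A : HyperplaneArrangement d n) (i : Fin n) :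
    EuclideanSpace ℝ (Fin d) →ᵃ[ℝ] ℝ :=
  (A i).form

/-- The points off the hyperplanes that lie on the positive sides indexed by `P` and on no others.
This is a tope unless it is empty. -/
def tope (A : HyperplaneArrangement d n) (P : Finset (Fin n)) : Set (EuclideanSpace ℝ (Fin d)) :=
  signCell A.forms P Pᶜ ∅

theorem forms_atInfinity : A.atInfinity.forms = linearParts A.forms :=
  funext fun _ => OrientedHyperplane.form_translateToOrigin

theorem mem_inter_iff : x ∈ A.inter S ↔ ∀ i ∈ S, A.forms i x = 0 := by
  simp only [inter, AffineSubspace.mem_iInf_iff, OrientedHyperplane.mem_toAffineSubspace_iff, forms]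

theorem mem_complement_iff : x ∈ A.complement ↔ ∀ i, A.forms i x ≠ 0 := by
  simp only [complement, Set.mem_compl_iff, Set.mem_iUnion, not_exists, SetLike.mem_coe,
    OrientedHyperplane.mem_toAffineSubspace_iff, forms, ne_eq]

theorem mem_tope_iff : x ∈ A.tope P ↔ x ∈ A.complement ∧ ∀ i, x ∈ (A i).posSide ↔ i ∈ P := by
  simp only [mem_complement_iff, OrientedHyperplane.mem_posSide_iff, ← forall_and]
  constructor
  · rintro ⟨hP, hN, -⟩ i
    by_cases hi : i ∈ P
    · exact ⟨(hP i hi).ne', iff_of_true (hP i hi) hi⟩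
    · have hneg := hN i (Finset.mem_compl.mpr hi)
      exact ⟨hneg.ne, iff_of_false hneg.not_gt hi⟩
  · intro h
    exact ⟨fun i hi => (h i).2.mpr hi, fun i hi => (h i).1.lt_or_gt.resolve_right fun hpos =>
      Finset.mem_compl.mp hi ((h i).2.mp hpos), by simp⟩

theorem exists_mem_tope (hx : x ∈ A.complement) : ∃ P, x ∈ A.tope P := by
  classical
  exact ⟨({i | x ∈ (A i).posSide} : Finset (Fin n)), mem_tope_iff.mpr ⟨hx, by simp⟩⟩

theorem eq_of_mem_tope {Q : Finset (Fin n)} (hP : x ∈ A.tope P) (hQ : x ∈ A.tope Q) : P = Q :=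
  Finset.ext fun i => ((mem_tope_iff.mp hP).2 i).symm.trans ((mem_tope_iff.mp hQ).2 i)

theorem mem_posSide_of_mem_connectedComponentIn (hy : y ∈ connectedComponentIn A.complement x)
    (hx : x ∈ (A i).posSide) : y ∈ (A i).posSide := by
  rw [OrientedHyperplane.mem_posSide_iff] at hx ⊢
  by_contra! hle
  have hxc : x ∈ connectedComponentIn A.complement x :=
    mem_connectedComponentIn (connectedComponentIn_nonempty_iff.mp ⟨y, hy⟩)
  obtain ⟨z, hz, hz₀⟩ := isPreconnected_connectedComponentIn.intermediate_value hy hxc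
    (A i).form.continuous_of_finiteDimensional.continuousOn ⟨hle, hx.le⟩
  exact mem_complement_iff.mp (connectedComponentIn_subset _ _ hz) i hz₀

theorem connectedComponentIn_eq_tope (hx : x ∈ A.tope P) :
    connectedComponentIn A.complement x = A.tope P := by
  obtain ⟨hxc, hxP⟩ := mem_tope_iff.mp hx
  ext y
  rw [mem_tope_iff]
  constructor
  · intro hy
    have hyx : x ∈ connectedComponentIn A.complement y :=
      connectedComponentIn_eq hy ▸ mem_connectedComponentIn hxc
    exact ⟨connectedComponentIn_subset _ _ hy, fun i => Iff.trans
      ⟨mem_posSide_of_mem_connectedComponentIn hyx, mem_posSide_of_mem_connectedComponentIn hy⟩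
      (hxP i)⟩
  · rintro ⟨hyc, hyP⟩
    rw [A.connectedComponentIn_eq_of_sides hxc hyc (Set.ext fun i => (hxP i).trans (hyP i).symm)]
    exact mem_connectedComponentIn hyc

theorem isTope_iff {T : Set (EuclideanSpace ℝ (Fin d))} :
    A.IsTope T ↔ ∃ P, (A.tope P).Nonempty ∧ A.tope P = T := by
  constructor
  · rintro ⟨x, hx, rfl⟩
    obtain ⟨P, hP⟩ := exists_mem_tope hx
    exact ⟨P, ⟨x, hP⟩, (connectedComponentIn_eq_tope hP).symm⟩
  · rintro ⟨P, ⟨x, hx⟩, rfl⟩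
    exact ⟨x, (mem_tope_iff.mp hx).1, (connectedComponentIn_eq_tope hx).symm⟩

theorem sigma_tope (h : (A.tope P).Nonempty) : A.sigma (A.tope P) = #P := by
  classical
  obtain ⟨x, hx⟩ := h
  refine congrArg Finset.card (Finset.ext fun i => ?_)
  rw [Finset.mem_filter_univ]
  exact ⟨fun hi => ((mem_tope_iff.mp hx).2 i).mp (hi hx),
    fun hi _ hy => ((mem_tope_iff.mp hy).2 i).mpr hi⟩

theorem sum_topes (g : Set (EuclideanSpace ℝ (Fin d)) → ℤ) :
    ∑ T ∈ A.topes, g T = ∑ P, feasibility A.forms P Pᶜ ∅ * g (A.tope P) := by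
  classical
  have htopes : A.topes = ({P | (A.tope P).Nonempty} : Finset (Finset (Fin n))).image A.tope := by
    ext T
    simp [topes, isTope_iff]
  have hinj : Set.InjOn A.tope {P | (A.tope P).Nonempty} := fun P ⟨x, hx⟩ Q _ hPQ =>
    eq_of_mem_tope hx (hPQ ▸ hx)
  rw [htopes, Finset.sum_image (by simpa using hinj), Finset.sum_filter]
  refine Finset.sum_congr rfl fun P _ => ?_
  by_cases hP : (A.tope P).Nonempty
  · rw [if_pos hP, feasibility_of_nonempty hP, one_mul]
  · rw [if_neg hP, feasibility_of_not_nonempty hP, zero_mul]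

theorem signedOddEven_topes : A.signedOddEven A.topes = signedCount A.forms := by
  rw [signedOddEven, sum_topes, signedCount]
  refine Finset.sum_congr rfl fun P _ => ?_
  by_cases hP : (A.tope P).Nonempty
  · rw [sigma_tope hP, mul_comm]
  · simp [feasibility_of_not_nonempty hP]

namespace IsSimple

theorem inGeneralPosition (hA : A.IsSimple) : InGeneralPosition A.forms where
  linearIndepOn S hS := by
    rw [finrank_euclideanSpace_fin] at hS
    obtain ⟨⟨x, hx⟩, hfin⟩ := hA.1 S hS
    let g : S → Dual ℝ (EuclideanSpace ℝ (Fin d)) := fun i => (A.forms i).linear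
    have hdir : (A.inter S).direction = (Submodule.span ℝ (Set.range g)).dualCoannihilator := by
      ext v
      rw [← AffineSubspace.vadd_mem_iff_mem_direction v hx, mem_inter_iff, ← SetLike.mem_coe,
        Submodule.coe_dualCoannihilator_span]
      simp only [Set.mem_ofPred_eq, Set.forall_mem_range, g, Subtype.forall]
      exact forall₂_congr fun i hi => by
        rw [AffineMap.map_vadd, mem_inter_iff.mp hx i hi, vadd_eq_add, add_zero]
    have hrank := Subspace.finrank_add_finrank_dualCoannihilator_eq
      (Submodule.span ℝ (Set.range g))
    rw [← hdir, hfin, finrank_euclideanSpace_fin] at hrank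
    refine linearIndependent_iff_card_eq_finrank_span.mpr ?_
    change Fintype.card S = finrank ℝ (Submodule.span ℝ (Set.range g))
    rw [Fintype.card_coe]
    omega
  card_le S x hx := by
    rw [finrank_euclideanSpace_fin]
    by_contra! hS
    exact Set.notMem_empty x (hA.2 S hS ▸ mem_inter_iff.mpr hx)

theorem two_mul_signedOddEven_topes [NeZero n] (hA : A.IsSimple) (hd : Odd d) :
    2 * A.signedOddEven A.topes = A.atInfinity.signedOddEven A.atInfinity.topes := by
  rw [signedOddEven_topes, signedOddEven_topes, forms_atInfinity]
  exact hA.inGeneralPosition.two_mul_signedCount (by rwa [finrank_euclideanSpace_fin])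

theorem signedOddEven_boundedTopes [NeZero n] (hA : A.IsSimple) :
    A.signedOddEven A.boundedTopes =
      A.signedOddEven A.topes - A.atInfinity.signedOddEven A.atInfinity.topes := by
  rw [signedOddEven_topes, signedOddEven_topes, forms_atInfinity, signedOddEven, boundedTopes,
    Finset.sum_filter, sum_topes, signedCount, signedCount, ← Finset.sum_sub_distrib]
  refine Finset.sum_congr rfl fun P _ => ?_
  have hbdd : IsBounded (A.tope P) ↔ _ := hA.inGeneralPosition.isBounded_signCell_iff
  by_cases hP : (A.tope P).Nonempty
  · rw [sigma_tope hP, feasibility_of_nonempty hP]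
    by_cases hlin : (signCell (linearParts A.forms) P Pᶜ ∅).Nonempty
    · simp [hbdd, hlin, feasibility_of_nonempty]
    · simp [hbdd, hlin, feasibility_of_not_nonempty]
  · have hlin := mt signCell_nonempty_of_linearParts hP
    simp [feasibility_of_not_nonempty hP, feasibility_of_not_nonempty hlin]

end IsSimple

theorem signedOddEven_topes_atInfinity_eq_zero (hn : Odd n) :
    A.atInfinity.signedOddEven A.atInfinity.topes = 0 := by
  rw [signedOddEven_topes, forms_atInfinity]
  exact signedCount_linearParts_eq_zero (by rwa [Fintype.card_fin])

end HyperplaneArrangement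

theorem theorem9 (d n : ℕ) (hd : Odd d) (A : HyperplaneArrangement d n) (hA : A.IsSimple) :
    (Odd n →
      A.signedOddEven A.topes = 0 ∧
      A.atInfinity.signedOddEven A.atInfinity.topes = 0 ∧
      A.signedOddEven A.boundedTopes = 0) ∧
    (Even n → 0 < n →
      (A.signedOddEven A.boundedTopes : ℚ) =
        -(1 / 2) * (A.atInfinity.signedOddEven A.atInfinity.topes : ℚ)) := by
  constructor
  · intro hn
    have : NeZero n := ⟨hn.pos.ne'⟩
    have hall := hA.two_mul_signedOddEven_topes hd
    have hbounded := hA.signedOddEven_boundedTopes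
    have hinfinity := A.signedOddEven_topes_atInfinity_eq_zero hn
    omega
  · intro _ hn
    have : NeZero n := ⟨hn.ne'⟩
    rw [hA.signedOddEven_boundedTopes, ← hA.two_mul_signedOddEven_topes hd]
    push_cast
    ring
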